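/- Let $B$ be a finite dimensional simple $\mathbb Q$-algebra whose center $F$ is a CM field, let $*$ be a positive involution on $B$ inducing complex conjugation on $F$, let $V$ be a nonzero finitely generated left $B$-module, and let $(\cdot,\cdot)$ be a non-degenerate $\mathbb Q$-valued alternating form on $V$ with $(bv,w)=(v,b^*w)$ for all $b\in B$, $v,w\in V$. Let $p$ be a prime number of good reduction in the sense of Kottwitz: $p$ is unramified in $F$, $B\otimes\mathbb Q_p$ is isomorphic to a matrix algebra over $F\otimes\mathbb Q_p$, and we are given a maximal $\mathbb Z_p$-order $\mathcal O\subset B\otimes\mathbb Q_p$ stable under $*$ and an $\mathcal O$-stable $\mathbb Z_p$-lattice $\Lambda\subset V\otimes\mathbb Q_p$ that is self-dual for $(\cdot,\cdot)$. Let $G$ be the group scheme over $\mathbb Z_p$ whose points in a commutative $\mathbb Z_p$-algebra $R$ are the $R$-linear automorphisms $g$ of $\Lambda\otimes_{\mathbb Z_p} R$ that commute with $\mathcal O$ and for which there is $c(g)\in R^\times$ with $(gv,gw)=c(g)(v,w)$ for all $v,w\in\Lambda\otimes_{\mathbb Z_p}R$. Let $G_1\subset G$ be the kernel of the similitude ratio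 $c$, so that $G_1(R)$ consists of the $g\in G(R)$ with $(gv,gw)=(v,w)$ for all $v,w$, and let $Z\subset G$ be the center of the group scheme $G$, so that $Z(R)$ consists of the $z\in G(R)$ whose image in $G(S)$ is central for every $R$-algebra $S$. Then the multiplication map $$G_1(\mathbb Z_p)\times Z(\mathbb Z_p)\longrightarrow G(\mathbb Z_p)$$ is surjective. -/

import Mathlib

open scoped TensorProduct NumberField

noncomputable section

namespace UnitaryPEL

/-- The algebraic part of a PEL datum of unitary type: `F` is a CM field, `B` is a finite
dimensional simple `ℚ`-algebra with centre `F`, with a positive involution `star` inducing complex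
conjugation on `F`, and `V` is a nonzero finitely generated left `B`-module with a nondegenerate
alternating `ℚ`-bilinear form such that `(b v, w) = (v, b* w)`. -/
structure Datum (F B V : Type*) [Field F] [NumberField F] [NumberField.IsCMField F]
    [Ring B] [Algebra ℚ B] [Algebra F B] [FiniteDimensional F B] [IsSimpleRing B]
    [Algebra.IsCentral F B] [StarRing B]
    [AddCommGroup V] [Module ℚ V] [Module B V] [Module.Finite B V] [Nontrivial V] where
  star_algebraMap : ∀ x : F,
    star (algebraMap F B x) = algebraMap F B (NumberField.IsCMField.complexConj F x)
  star_positive : ∀ b : B, b ≠ 0 → 0 < LinearMap.trace ℚ B (LinearMap.mulLeft ℚ (b * star b))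
  form : LinearMap.BilinForm ℚ V
  form_alt : form.IsAlt
  form_nondegenerate : form.Nondegenerate
  form_smul : ∀ (b : B) (v w : V), form (b • v) w = form v (star b • w)

section Local

variable (p : ℕ) [Fact p.Prime]

/-- The involution of `ℚ_p ⊗ B` extending `star`, as a `ℚ_p`-linear map. -/
def starLocal (B : Type*) [Ring B] [Algebra ℚ B] [StarRing B] :
    (ℚ_[p] ⊗[ℚ] B) →ₗ[ℚ_[p]] (ℚ_[p] ⊗[ℚ] B) :=
  (starAddEquiv (R := B)).toAddMonoidHom.toRatLinearMap.baseChange ℚ_[p]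

/-- The action of `ℚ_p ⊗ B` on `ℚ_p ⊗ V`, with `(a ⊗ b) (c ⊗ v) = (a c) ⊗ (b v)`. -/
def actionLocal (B V : Type*) [Ring B] [Algebra ℚ B] [AddCommGroup V] [Module ℚ V] [Module B V] :
    (ℚ_[p] ⊗[ℚ] B) →ₐ[ℚ_[p]] Module.End ℚ_[p] (ℚ_[p] ⊗[ℚ] V) :=
  Algebra.TensorProduct.lift (Algebra.ofId ℚ_[p] _)
    ((Module.End.baseChangeHom ℚ ℚ_[p] V).comp (Algebra.lsmul ℚ ℚ V))
    (fun a _ => by rw [Algebra.ofId_apply]; exact Algebra.commute_algebraMap_left a _)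

theorem actionLocal_tmul (B V : Type*) [Ring B] [Algebra ℚ B] [AddCommGroup V] [Module ℚ V]
    [Module B V] (a c : ℚ_[p]) (b : B) (v : V) :
    actionLocal p B V (a ⊗ₜ[ℚ] b) (c ⊗ₜ[ℚ] v) = (a * c) ⊗ₜ[ℚ] (b • v) := by
  rw [actionLocal, Algebra.TensorProduct.lift_tmul]
  change a • (c ⊗ₜ[ℚ] (b • v)) = _
  rw [TensorProduct.smul_tmul', smul_eq_mul]

end Local

variable {F B V : Type*} [Field F] [NumberField F] [NumberField.IsCMField F]
    [Ring B] [Algebra ℚ B] [Algebra F B] [FiniteDimensional F B] [IsSimpleRing B]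
    [Algebra.IsCentral F B] [StarRing B]
    [AddCommGroup V] [Module ℚ V] [Module B V] [Module.Finite B V] [Nontrivial V]

/-- Good reduction at `p`, in the sense of Kottwitz, together with the integral data at `p`.
The algebra `B` is unramified at `p`, that is, `p` is unramified in the centre `F` and
`B ⊗ ℚ_p` is a matrix algebra over `F ⊗ ℚ_p` (a product of unramified extensions of `ℚ_p`).
The integral data are a maximal `ℤ_p`-order in `B ⊗ ℚ_p` stable under the involution, and a
self-dual `ℤ_p`-lattice in `V ⊗ ℚ_p` stable under the order. -/
structure Datum.GoodReduction (D : Datum F B V) (p : ℕ) [Fact p.Prime] where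
  unramified : Algebra.IsUnramifiedIn (𝓞 F) (Ideal.span {(p : ℤ)})
  split : ∃ d : ℕ, Nonempty
    (((F ⊗[ℚ] ℚ_[p]) ⊗[F] B) ≃ₐ[F ⊗[ℚ] ℚ_[p]] Matrix (Fin d) (Fin d) (F ⊗[ℚ] ℚ_[p]))
  order : Subalgebra ℤ_[p] (ℚ_[p] ⊗[ℚ] B)
  order_isLattice : (Subalgebra.toSubmodule order).IsLattice ℚ_[p]
  order_maximal : ∀ O : Subalgebra ℤ_[p] (ℚ_[p] ⊗[ℚ] B),
    (Subalgebra.toSubmodule O).IsLattice ℚ_[p] → order ≤ O → O = order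
  order_star : ∀ b ∈ order, starLocal p B b ∈ order
  lattice : Submodule ℤ_[p] (ℚ_[p] ⊗[ℚ] V)
  lattice_isLattice : lattice.IsLattice ℚ_[p]
  lattice_stable : ∀ b ∈ order, ∀ v ∈ lattice, actionLocal p B V b v ∈ lattice
  lattice_selfDual : ∀ v : ℚ_[p] ⊗[ℚ] V,
    v ∈ lattice ↔ ∀ w ∈ lattice, ‖D.form.baseChange ℚ_[p] v w‖ ≤ 1

namespace Datum.GoodReduction

variable {D : Datum F B V} {p : ℕ} [Fact p.Prime] (M : D.GoodReduction p)

/-- The action of an element of the order on the lattice. -/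
def orderAction (b : M.order) : Module.End ℤ_[p] M.lattice :=
  ((actionLocal p B V b).restrictScalars ℤ_[p]).restrict (M.lattice_stable b b.2)

/-- The `ℤ_p`-valued form on the lattice. -/
def latticeForm : LinearMap.BilinForm ℤ_[p] M.lattice :=
  LinearMap.mk₂ ℤ_[p]
    (fun v w => (⟨D.form.baseChange ℚ_[p] (v : ℚ_[p] ⊗[ℚ] V) (w : ℚ_[p] ⊗[ℚ] V),
      (M.lattice_selfDual v).1 v.2 w w.2⟩ : ℤ_[p]))
    (fun v v' w => PadicInt.ext (by
      change D.form.baseChange ℚ_[p] ((v : ℚ_[p] ⊗[ℚ] V) + v') w =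
        D.form.baseChange ℚ_[p] v w + D.form.baseChange ℚ_[p] v' w
      rw [map_add, LinearMap.add_apply]))
    (fun c v w => PadicInt.ext (by
      change D.form.baseChange ℚ_[p] ((c : ℚ_[p]) • (v : ℚ_[p] ⊗[ℚ] V)) w =
        c * D.form.baseChange ℚ_[p] v w
      rw [map_smul, LinearMap.smul_apply, smul_eq_mul]))
    (fun v w w' => PadicInt.ext (by
      change D.form.baseChange ℚ_[p] v ((w : ℚ_[p] ⊗[ℚ] V) + w') =
        D.form.baseChange ℚ_[p] v w + D.form.baseChange ℚ_[p] v w'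
      rw [map_add]))
    (fun c v w => PadicInt.ext (by
      change D.form.baseChange ℚ_[p] v ((c : ℚ_[p]) • (w : ℚ_[p] ⊗[ℚ] V)) =
        c * D.form.baseChange ℚ_[p] v w
      rw [map_smul, smul_eq_mul]))

section Points

variable (R : Type) [CommRing R] [Algebra ℤ_[p] R]

/-- The `R`-points of the integral model of the group `G` of unitary similitudes: the
automorphisms of `R ⊗ Λ` which commute with the order and preserve the form up to a scalar
in `Rˣ`. -/
def G : Subgroup ((R ⊗[ℤ_[p]] M.lattice) ≃ₗ[R] (R ⊗[ℤ_[p]] M.lattice)) where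
  carrier := {g | (∀ (b : M.order) (v : R ⊗[ℤ_[p]] M.lattice),
      g ((M.orderAction b).baseChange R v) = (M.orderAction b).baseChange R (g v)) ∧
    ∃ c : Rˣ, ∀ v w : R ⊗[ℤ_[p]] M.lattice,
      M.latticeForm.baseChange R (g v) (g w) = c * M.latticeForm.baseChange R v w}
  mul_mem' := by
    rintro g h ⟨hg, c, hc⟩ ⟨hh, d, hd⟩
    refine ⟨fun b v => ?_, c * d, fun v w => ?_⟩
    · simp only [LinearEquiv.mul_apply, hh, hg]
    · simp only [LinearEquiv.mul_apply, hc, hd, Units.val_mul, mul_assoc]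
  one_mem' := ⟨fun _ _ => rfl, 1, fun v w => by simp⟩
  inv_mem' := by
    rintro g ⟨hg, c, hc⟩
    have e : ∀ v, g (g⁻¹ v) = v := fun v => g.apply_symm_apply v
    refine ⟨fun b v => g.injective ?_, c⁻¹, fun v w => ?_⟩
    · rw [e, hg, e]
    · have h := hc (g⁻¹ v) (g⁻¹ w)
      rw [e, e] at h
      rw [h, Units.inv_mul_cancel_left]

/-- The `R`-points of `G_1`, the kernel of the similitude ratio: the elements of `G(R)` which
preserve the form. -/
def G1 : Subgroup (M.G R) where
  carrier := {g | ∀ v w : R ⊗[ℤ_[p]] M.lattice,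
      M.latticeForm.baseChange R (g.1 v) (g.1 w) = M.latticeForm.baseChange R v w}
  mul_mem' := by
    intro g h hg hh v w
    exact (hg _ _).trans (hh v w)
  one_mem' := fun _ _ => rfl
  inv_mem' := by
    intro g hg v w
    have e : ∀ v, g.1 ((g⁻¹).1 v) = v := fun v => g.1.apply_symm_apply v
    have := hg ((g⁻¹).1 v) ((g⁻¹).1 w)
    rw [e, e] at this
    exact this.symm

end Points

section Functoriality

variable (R S : Type) [CommRing R] [Algebra ℤ_[p] R] [CommRing S] [Algebra ℤ_[p] S]
  [Algebra R S] [IsScalarTower ℤ_[p] R S]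

/-- The canonical identification `S ⊗_R (R ⊗ Λ) = S ⊗ Λ`. -/
abbrev cancel : S ⊗[R] (R ⊗[ℤ_[p]] M.lattice) ≃ₗ[S] S ⊗[ℤ_[p]] M.lattice :=
  TensorProduct.AlgebraTensorModule.cancelBaseChange ℤ_[p] R S S M.lattice

theorem form_cancel (x y : S ⊗[R] (R ⊗[ℤ_[p]] M.lattice)) :
    M.latticeForm.baseChange S (M.cancel R S x) (M.cancel R S y) =
      (M.latticeForm.baseChange R).baseChange S x y := by
  induction x with
  | zero => simp
  | add x x' hx hx' => simp only [map_add, LinearMap.add_apply, hx, hx']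
  | tmul s u =>
    induction y with
    | zero => simp
    | add y y' hy hy' => simp only [map_add, hy, hy']
    | tmul t w =>
      induction u with
      | zero => simp
      | add u u' hu hu' =>
        simp only [TensorProduct.tmul_add, map_add, LinearMap.add_apply, hu, hu']
      | tmul r m =>
        induction w with
        | zero => simp
        | add w w' hw hw' => simp only [TensorProduct.tmul_add, map_add, hw, hw']
        | tmul r' m' =>
          simp only [TensorProduct.AlgebraTensorModule.cancelBaseChange_tmul,
            LinearMap.BilinForm.baseChange_tmul, Algebra.smul_def, map_mul,
            ← IsScalarTower.algebraMap_apply]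
          ring

theorem action_cancel (b : M.order) (x : S ⊗[R] (R ⊗[ℤ_[p]] M.lattice)) :
    (M.orderAction b).baseChange S (M.cancel R S x) =
      M.cancel R S (((M.orderAction b).baseChange R).baseChange S x) := by
  induction x with
  | zero => simp
  | add x y hx hy => simp only [map_add, hx, hy]
  | tmul s u =>
    induction u with
    | zero => simp
    | add u v hu hv => simp only [TensorProduct.tmul_add, map_add, hu, hv]
    | tmul r m => simp

/-- The homomorphism `G(R) → G(S)` attached to an `R`-algebra `S`: base change of automorphisms
along `R → S`. -/
def mapG : M.G R →* M.G S where
  toFun g := ⟨(M.cancel R S).symm ≪≫ₗ g.1.baseChange R S _ _ ≪≫ₗ M.cancel R S, by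
    obtain ⟨g, hg, c, hc⟩ := g
    have hb : ∀ (b : M.order) (x : S ⊗[R] (R ⊗[ℤ_[p]] M.lattice)),
        g.baseChange R S _ _ (((M.orderAction b).baseChange R).baseChange S x) =
          ((M.orderAction b).baseChange R).baseChange S (g.baseChange R S _ _ x) := by
      intro b x
      induction x with
      | zero => simp
      | add x y hx hy => simp only [map_add, hx, hy]
      | tmul s u => simp only [LinearMap.baseChange_tmul, LinearEquiv.baseChange_tmul, hg]
    have hf : ∀ x y : S ⊗[R] (R ⊗[ℤ_[p]] M.lattice),
        (M.latticeForm.baseChange R).baseChange S (g.baseChange R S _ _ x)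
          (g.baseChange R S _ _ y) =
        algebraMap R S c * (M.latticeForm.baseChange R).baseChange S x y := by
      intro x y
      induction x with
      | zero => simp
      | add x x' hx hx' => simp only [map_add, LinearMap.add_apply, hx, hx', mul_add]
      | tmul s u =>
        induction y with
        | zero => simp
        | add y y' hy hy' => simp only [map_add, hy, hy', mul_add]
        | tmul t w =>
          simp only [LinearEquiv.baseChange_tmul, LinearMap.BilinForm.baseChange_tmul, hc,
            Algebra.smul_def, map_mul]
          ring
    refine ⟨fun b v => ?_, Units.map (algebraMap R S).toMonoidHom c, fun v w => ?_⟩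
    · obtain ⟨x, rfl⟩ := (M.cancel R S).surjective v
      simp only [action_cancel, LinearEquiv.trans_apply, LinearEquiv.symm_apply_apply, hb]
    · obtain ⟨x, rfl⟩ := (M.cancel R S).surjective v
      obtain ⟨y, rfl⟩ := (M.cancel R S).surjective w
      simp only [LinearEquiv.trans_apply, LinearEquiv.symm_apply_apply, form_cancel, hf]
      rfl⟩
  map_one' := by
    ext1
    ext1 v
    simp
  map_mul' g h := by
    ext1
    ext1 v
    simp [LinearEquiv.baseChange_mul]

end Functoriality

/-- The `R`-points of the centre `Z` of the group scheme `G`: the elements of `G(R)` whose image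
in `G(S)` is central for every `R`-algebra `S`. -/
def Z (R : Type) [CommRing R] [Algebra ℤ_[p] R] : Subgroup (M.G R) where
  carrier := {z | ∀ (S : Type) [CommRing S] [Algebra ℤ_[p] S] [Algebra R S]
    [IsScalarTower ℤ_[p] R S], M.mapG R S z ∈ Subgroup.center (M.G S)}
  mul_mem' := by
    intro z w hz hw S _ _ _ _
    rw [map_mul]
    exact mul_mem (hz S) (hw S)
  one_mem' := by
    intro S _ _ _ _
    rw [map_one]
    exact one_mem _
  inv_mem' := by
    intro z hz S _ _ _ _
    rw [map_inv]
    exact inv_mem (hz S)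

/-- The multiplication map `G_1(R) × Z(R) → G(R)`. -/
def mulMap (R : Type) [CommRing R] [Algebra ℤ_[p] R] (x : M.G1 R × M.Z R) : M.G R :=
  (x.1 : M.G R) * (x.2 : M.G R)

end Datum.GoodReduction

end UnitaryPEL

end

/-!
The similitude ratio already takes all its values on the centre. Given `g` in `G(ℤ_p)` of ratio `c`,
it suffices to find a central `ζ` of the same ratio `c`, for then `g * ζ⁻¹` preserves the form and
`g = (g * ζ⁻¹) * ζ`.

Let `A = ℤ_p ⊗ 𝓞 F`, with complex conjugation `σ`. A maximal order contains the image of `A`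
(`integersToLocal_mem_order`), since the products of its elements with those of `A` span an order.
As `star` induces `σ` on `A`, an element `z` of `A` with `z * σ z = c` acts on the lattice as a
similitude of ratio `c`. It is central, because after every base change the elements of `G` commute
with the order (`mem_Z_of_eq_orderAction`).

The existence of `z` (`exists_mul_map_involution_eq_of_isUnramifiedIn`) is where `p` being unramified
in `F` is used, uniformly in `p`, including `p = 2`. The ring `𝓞 F / p` is a finite product of finite
fields, which `σ` permutes. At a pair of exchanged factors the equation is solved by `(c, 1)`. On a
factor preserved by `σ` the involution is nontrivial, since inertia groups at `p` are trivial
(`AlgEquiv.eq_refl_of_isUnramifiedAt`), and the norm map of a quadratic extension of finite fields is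
surjective (`exists_mul_involution_eq_of_finite_field`). The same argument with sums provides `t`
with `t + σ t = 1`, and with such a `t` the solution modulo `p` is lifted to `A` by Newton iteration
(`exists_mul_involution_eq_of_mod`).
-/

/-! ### Involutions of finite fields -/

/-- Hilbert 90 for an involution `σ` of a finite field `k` bounds the kernel of `z ↦ z * σ z`;
comparing cardinalities, every element of the fixed field is of the form `z * σ z`. -/
theorem exists_mul_involution_eq_of_finite_field {k : Type*} [Field k] [Finite k] (σ : k ≃+* k)
    (hσ : ∀ x, σ (σ x) = x) (hne : ∃ x, σ x ≠ x) {c : k} (hc : σ c = c) :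
    ∃ z, z * σ z = c := by
  rcases eq_or_ne c 0 with rfl | hc0
  · exact ⟨0, by simp⟩
  let τ : kˣ →* kˣ := Units.map (σ : k →* k)
  have hτ : ∀ u : kˣ, ((τ u : kˣ) : k) = σ u := fun _ => rfl
  let N : kˣ →* kˣ := MonoidHom.id kˣ * τ
  let D : kˣ →* kˣ := MonoidHom.id kˣ / τ
  have hN : ∀ u : kˣ, ((N u : kˣ) : k) = u * σ u := fun _ => rfl
  have hD : ∀ u : kˣ, D u = u / τ u := fun _ => rfl
  -- Hilbert 90: an element `u` of norm one is `w / σ w` with `w = a + u * σ a`.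
  have hND : N.ker ≤ D.range := by
    intro u hu
    have hu' : (u : k) * σ u = 1 := by rw [← hN, hu, Units.val_one]
    obtain ⟨a, ha⟩ : ∃ a : k, a + u * σ a ≠ 0 := by
      by_contra! h
      have h1 : (u : k) = -1 := by
        have := h 1
        rw [map_one, mul_one] at this
        exact eq_neg_of_add_eq_zero_right this
      obtain ⟨x, hx⟩ := hne
      apply hx
      have := h x
      rw [h1] at this
      linear_combination -this
    have hw : (u : k) * σ (a + u * σ a) = a + u * σ a := by
      rw [map_add, map_mul, hσ]
      linear_combination a * hu'
    refine ⟨Units.mk0 _ ha, ?_⟩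
    rw [hD, div_eq_iff_eq_mul]
    exact Units.ext hw.symm
  have hle : N.range ≤ D.ker := by
    rintro _ ⟨u, rfl⟩
    rw [MonoidHom.mem_ker, hD, div_eq_one]
    ext
    rw [hτ, hN, map_mul, hσ, mul_comm]
  have hcard : Nat.card D.ker ≤ Nat.card N.range := by
    have h1 := N.ker.card_mul_index
    have h2 := D.ker.card_mul_index
    rw [Subgroup.index_ker] at h1 h2
    have h3 : Nat.card N.ker ≤ Nat.card D.range := Subgroup.card_le_of_le hND
    have h4 : 0 < Nat.card D.range := Nat.card_pos
    by_contra! h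
    have : Nat.card N.ker * Nat.card N.range < Nat.card D.ker * Nat.card D.range := by
      calc _ ≤ Nat.card D.range * Nat.card N.range := Nat.mul_le_mul_right _ h3
        _ < Nat.card D.range * Nat.card D.ker := Nat.mul_lt_mul_of_pos_left h h4
        _ = _ := mul_comm _ _
    omega
  have heq : N.range = D.ker := Subgroup.eq_of_le_of_card_ge hle hcard
  have hmem : Units.mk0 c hc0 ∈ D.ker := by
    rw [MonoidHom.mem_ker, hD, div_eq_one]
    exact Units.ext hc.symm
  rw [← heq] at hmem
  obtain ⟨u, hu⟩ := hmem
  exact ⟨u, by rw [← hN, hu, Units.val_mk0]⟩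

/-- If `x + σ x` vanished identically, `x = 1` would give characteristic two and hence `σ = 1`. -/
theorem exists_add_involution_eq_one_of_field {k : Type*} [Field k] (σ : k ≃+* k)
    (hσ : ∀ x, σ (σ x) = x) (hne : ∃ x, σ x ≠ x) : ∃ t, t + σ t = 1 := by
  obtain ⟨x, hx⟩ : ∃ x, x + σ x ≠ 0 := by
    by_contra! h
    obtain ⟨x, hx⟩ := hne
    apply hx
    have h2 : (1 : k) + 1 = 0 := by simpa using h 1
    linear_combination h x - x * h2
  refine ⟨x / (x + σ x), ?_⟩
  rw [map_div₀, map_add, hσ, add_comm (σ x) x, ← add_div, div_self hx]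

/-! ### Involutions of finite reduced rings -/

/-- A twisted equation `f z (σ z) = c` in a reduced Artinian ring with an involution `σ` can be
solved one maximal ideal at a time: at the maximal ideals fixed by `σ` a solution is required, and
at a pair of maximal ideals exchanged by `σ` the values `a` and `b` are prescribed. -/
theorem exists_apply_involution_eq {k : Type*} [CommRing k] [IsArtinianRing k] [IsReduced k]
    (σ : k ≃+* k) (hσ : ∀ x, σ (σ x) = x) (f : k → k → k)
    (hf : ∀ (I : Ideal k) (x x' y y' : k), x - x' ∈ I → y - y' ∈ I → f x y - f x' y' ∈ I)
    {a b c : k} (hab : f a (σ b) = c) (hba : f b (σ a) = c)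
    (hfix : ∀ P : Ideal k, P.IsMaximal → P.comap σ = P → ∃ x, f x (σ x) - c ∈ P) :
    ∃ z, f z (σ z) = c := by
  classical
  obtain ⟨n, ⟨e⟩⟩ := Finite.exists_equiv_fin (MaximalSpectrum k)
  let s : MaximalSpectrum k → MaximalSpectrum k := fun P =>
    ⟨P.asIdeal.comap σ, Ideal.comap_isMaximal_of_equiv σ (hp := P.isMaximal)⟩
  have hs : ∀ P, s (s P) = P := by
    intro P
    ext x
    change σ (σ x) ∈ P.asIdeal ↔ _
    rw [hσ]
  have hfix' : ∀ P : MaximalSpectrum k, s P = P → ∃ x, f x (σ x) - c ∈ P.asIdeal := fun P hP =>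
    hfix P.asIdeal P.isMaximal (congrArg MaximalSpectrum.asIdeal hP)
  choose! w hw using hfix'
  -- An arbitrary ordering of the maximal ideals picks one element of each pair.
  let x : MaximalSpectrum k → k := fun P =>
    if s P = P then w P else if e P < e (s P) then a else b
  obtain ⟨z, hz⟩ := (IsArtinianRing.equivPi k).surjective (fun P => Ideal.Quotient.mk _ (x P))
  have hzx : ∀ P : MaximalSpectrum k, z - x P ∈ P.asIdeal := by
    intro P
    rw [← Ideal.Quotient.eq, ← congrFun hz P]
    rfl
  refine ⟨z, (IsArtinianRing.equivPi k).injective (funext fun P => ?_)⟩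
  rw [IsArtinianRing.equivPi_apply, IsArtinianRing.equivPi_apply]
  refine Ideal.Quotient.eq.2 ?_
  have hσz : σ z - σ (x (s P)) ∈ P.asIdeal := by
    rw [← map_sub]
    exact hzx (s P)
  have h := hf _ _ _ _ _ (hzx P) hσz
  suffices h' : f (x P) (σ (x (s P))) - c ∈ P.asIdeal by
    have := add_mem h h'
    rwa [sub_add_sub_cancel] at this
  by_cases hP : s P = P
  · rw [hP]
    simpa only [x, if_pos hP] using hw P hP
  · have hP' : ¬ s (s P) = s P := by rw [hs]; exact fun h => hP h.symm
    have hne : e P ≠ e (s P) := fun h => hP (e.injective h).symm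
    rcases lt_or_gt_of_ne hne with hlt | hlt
    · simp only [x, if_neg hP, if_neg hP', hs, if_pos hlt, if_neg hlt.not_gt, hab, sub_self,
        zero_mem]
    · simp only [x, if_neg hP, if_neg hP', hs, if_pos hlt, if_neg hlt.not_gt, hba, sub_self,
        zero_mem]

section FiniteReduced

variable {k : Type*} [CommRing k] [Finite k] [IsReduced k] (σ : k ≃+* k) (hσ : ∀ x, σ (σ x) = x)
  (hne : ∀ P : Ideal k, P.IsMaximal → P.comap σ = P → ∃ x, σ x - x ∉ P)

include hσ hne in
theorem exists_mul_involution_eq_of_finite_reduced {c : k} (hc : σ c = c) : ∃ z, z * σ z = c := by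
  refine exists_apply_involution_eq σ hσ (fun x y => x * y) ?_ (a := c) (b := 1)
    (by rw [map_one, mul_one]) (by rw [hc, one_mul]) ?_
  · intro I x x' y y' hx hy
    have : x * y - x' * y' = (x - x') * y + x' * (y - y') := by ring
    rw [this]
    exact add_mem (I.mul_mem_right _ hx) (I.mul_mem_left _ hy)
  · intro P hP hPσ
    let _ : Field (k ⧸ P) := Ideal.Quotient.field P
    have : Finite (k ⧸ P) := Finite.of_surjective _ Ideal.Quotient.mk_surjective
    let τ : (k ⧸ P) ≃+* (k ⧸ P) := Ideal.quotientEquiv P P σ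
      (by conv_rhs => rw [← hPσ]
          exact (Ideal.map_comap_of_surjective (σ : k →+* k) σ.surjective P).symm)
    have hτ : ∀ x, τ (Ideal.Quotient.mk P x) = Ideal.Quotient.mk P (σ x) := fun _ => rfl
    obtain ⟨y, hy⟩ := exists_mul_involution_eq_of_finite_field τ
      (fun x => by
        obtain ⟨x, rfl⟩ := Ideal.Quotient.mk_surjective x
        rw [hτ, hτ, hσ])
      (by
        obtain ⟨x, hx⟩ := hne P hP hPσ
        exact ⟨Ideal.Quotient.mk P x, fun h => hx (Ideal.Quotient.eq.1 h)⟩)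
      (c := Ideal.Quotient.mk P c) (by rw [hτ, hc])
    obtain ⟨x, rfl⟩ := Ideal.Quotient.mk_surjective y
    exact ⟨x, Ideal.Quotient.eq.1 hy⟩

include hσ hne in
theorem exists_add_involution_eq_one_of_finite_reduced : ∃ t, t + σ t = 1 := by
  refine exists_apply_involution_eq σ hσ (fun x y => x + y) ?_ (a := 1) (b := 0)
    (by rw [map_zero, add_zero]) (by rw [map_one, zero_add]) ?_
  · intro I x x' y y' hx hy
    rw [add_sub_add_comm]
    exact add_mem hx hy
  · intro P hP hPσ
    let _ : Field (k ⧸ P) := Ideal.Quotient.field P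
    let τ : (k ⧸ P) ≃+* (k ⧸ P) := Ideal.quotientEquiv P P σ
      (by conv_rhs => rw [← hPσ]
          exact (Ideal.map_comap_of_surjective (σ : k →+* k) σ.surjective P).symm)
    have hτ : ∀ x, τ (Ideal.Quotient.mk P x) = Ideal.Quotient.mk P (σ x) := fun _ => rfl
    obtain ⟨y, hy⟩ := exists_add_involution_eq_one_of_field τ
      (fun x => by
        obtain ⟨x, rfl⟩ := Ideal.Quotient.mk_surjective x
        rw [hτ, hτ, hσ])
      (by
        obtain ⟨x, hx⟩ := hne P hP hPσ
        exact ⟨Ideal.Quotient.mk P x, fun h => hx (Ideal.Quotient.eq.1 h)⟩)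
    obtain ⟨x, rfl⟩ := Ideal.Quotient.mk_surjective y
    exact ⟨x, Ideal.Quotient.eq.1 hy⟩

end FiniteReduced

/-! ### Lifting along an adically complete ideal -/

/-- A finite module over an adically complete Noetherian ring is adically complete. -/
theorem IsAdicComplete.of_finite_of_isNoetherianRing {R : Type*} [CommRing R] [IsNoetherianRing R]
    (I : Ideal R) [IsAdicComplete I R] (M : Type*) [AddCommGroup M] [Module R M]
    [Module.Finite R M] : IsAdicComplete I M := by
  obtain ⟨n, f, hf⟩ := Module.Finite.exists_fin' R M
  have hfree : Function.Surjective (AdicCompletion.of I (Fin n → R)) := by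
    intro y
    obtain ⟨x, rfl⟩ := (AdicCompletion.piEquivOfFintype I (fun _ : Fin n => R)).symm.surjective y
    choose r hr using fun i => AdicCompletion.of_surjective I R (x i)
    refine ⟨r, ?_⟩
    rw [LinearEquiv.eq_symm_apply]
    funext i
    rw [← hr i]
    rfl
  have : IsPrecomplete I M := by
    refine AdicCompletion.of_surjective_iff.1 fun y => ?_
    obtain ⟨x, rfl⟩ := AdicCompletion.map_surjective I hf y
    obtain ⟨x, rfl⟩ := hfree x
    exact ⟨f x, rfl⟩
  have : IsHausdorff I M := .of_le_jacobson I M (IsAdicComplete.le_jacobson_bot I)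
  exact { }

section Lifting

variable {A : Type*} [CommRing A] (I : Ideal A) [IsAdicComplete I A] (σ : A ≃+* A)

/-- When `t + σ t` is congruent to `1` it is a unit fixed by `σ`, by which `t` can be divided. -/
theorem exists_add_involution_eq_one_of_mod (hσ : ∀ x, σ (σ x) = x) {t : A}
    (ht : t + σ t - 1 ∈ I) :
    ∃ t, t + σ t = 1 := by
  have hu : IsUnit (t + σ t) := by
    have := IsAdicComplete.le_jacobson_bot I ht
    rw [Ideal.mem_jacobson_bot] at this
    simpa using this 1
  obtain ⟨u, hu⟩ := hu
  have hσu : σ u = u := by rw [hu, map_add, hσ, add_comm]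
  have hσu' : σ ↑u⁻¹ = ↑u⁻¹ := by
    refine Units.eq_inv_of_mul_eq_one_right ?_
    rw [← hσu, ← map_mul, Units.inv_mul, map_one]
  refine ⟨t * ↑u⁻¹, ?_⟩
  rw [map_mul, hσu', ← add_mul, ← hu, Units.mul_inv]

/-- Newton iteration for `z * σ z = c`: when `t + σ t = 1` and `y = z * σ z - c`, replacing `z` by
`z * (1 - c⁻¹ * y * t)` replaces `y` by a multiple of `y ^ 2`. -/
theorem exists_mul_involution_eq_of_mod (hI : I ≤ I.comap σ) {t : A} (ht : t + σ t = 1)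
    (hσ : ∀ x, σ (σ x) = x)
    {c : Aˣ} (hc : σ c = c) {z : A} (hz : z * σ z - c ∈ I) : ∃ z, z * σ z = c := by
  have hc' : σ ↑c⁻¹ = ↑c⁻¹ := by
    refine Units.eq_inv_of_mul_eq_one_right ?_
    rw [← hc, ← map_mul, Units.inv_mul, map_one]
  have hcc : (c : A) * ↑c⁻¹ = 1 := c.mul_inv
  let next : A → A := fun z => z * (1 - ↑c⁻¹ * (z * σ z - c) * t)
  have hnext : ∀ z, next z * σ (next z) - c = (z * σ z - c) ^ 2 *
      (↑c⁻¹ ^ 2 * (t * σ t) * (z * σ z) - ↑c⁻¹) := by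
    intro z
    have h1 : σ (next z) = σ z * (1 - ↑c⁻¹ * (z * σ z - c) * σ t) := by
      simp only [next, map_mul, map_sub, map_one, hσ, hc, hc']
      ring
    rw [h1]
    have h2 : σ t = 1 - t := by rw [← ht]; ring
    simp only [next]
    rw [h2]
    generalize σ z = w
    generalize ((c⁻¹ : Aˣ) : A) = d at *
    generalize (c : A) = c at *
    linear_combination (c - z * w) * hcc
  let q : ℕ → A := fun n => next^[n] z
  have hq : ∀ n, q (n + 1) = next (q n) := fun n => Function.iterate_succ_apply' _ _ _
  have hqI : ∀ n, q n * σ (q n) - c ∈ I ^ (n + 1) := by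
    intro n
    induction n with
    | zero => rw [zero_add, pow_one]; exact hz
    | succ n ih =>
      rw [hq, hnext]
      refine Ideal.mul_mem_right _ _ (Ideal.pow_le_pow_right (n := (n + 1) * 2) (by omega) ?_)
      rw [pow_mul]
      exact Ideal.pow_mem_pow ih 2
  have hstep : ∀ n, q n ≡ q (n + 1) [SMOD (I ^ n • ⊤ : Submodule A A)] := by
    intro n
    rw [SModEq.sub_mem, smul_eq_mul, Ideal.mul_top, hq]
    have : q n - next (q n) = (q n * σ (q n) - c) * (q n * ↑c⁻¹ * t) := by
      simp only [next]; ring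
    rw [this]
    exact Ideal.mul_mem_right _ _ (Ideal.pow_le_pow_right (Nat.le_succ n) (hqI n))
  have hmono : ∀ {m n : ℕ}, m ≤ n → q m ≡ q n [SMOD (I ^ m • ⊤ : Submodule A A)] := by
    intro m n hmn
    induction n, hmn using Nat.le_induction with
    | base => exact SModEq.rfl
    | succ n hmn ih =>
      exact ih.trans ((hstep n).mono (Submodule.smul_mono_left (Ideal.pow_le_pow_right hmn)))
  obtain ⟨L, hL⟩ := IsPrecomplete.prec (I := I) inferInstance hmono
  -- The limit solves the equation modulo every power of `I`.
  refine ⟨L, sub_eq_zero.1 (IsHausdorff.haus (I := I) inferInstance _ fun n => ?_)⟩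
  rw [SModEq.zero, smul_eq_mul, Ideal.mul_top]
  have h1 : q n - L ∈ I ^ n := by
    have := hL n
    rwa [SModEq.sub_mem, smul_eq_mul, Ideal.mul_top] at this
  have h2 : σ (q n - L) ∈ I ^ n :=
    Ideal.le_comap_pow (σ : A →+* A) n (Ideal.pow_right_mono hI n h1)
  have h3 : q n * σ (q n) - c ∈ I ^ n := Ideal.pow_le_pow_right (Nat.le_succ n) (hqI n)
  have : L * σ L - c = (q n * σ (q n) - c) - ((q n - L) * σ (q n) + L * σ (q n - L)) := by
    rw [map_sub]; ring
  rw [this]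
  exact sub_mem h3 (add_mem (Ideal.mul_mem_right _ _ h1) (Ideal.mul_mem_left _ _ h2))

end Lifting

/-! ### Unramified primes and involutions -/

/-- The inertia group of an unramified prime is trivial: an automorphism of a Noetherian domain
preserving an unramified prime `P` and acting trivially on its residue ring is the identity. -/
theorem AlgEquiv.eq_refl_of_isUnramifiedAt {R S : Type*} [CommRing R] [CommRing S] [IsDomain S]
    [IsNoetherianRing S] [Algebra R S] (P : Ideal S) [P.IsPrime] [Algebra.IsUnramifiedAt R P]
    (σ : S ≃ₐ[R] S) (hP : P.comap σ = P) (h : ∀ x, σ x - x ∈ P) : σ = AlgEquiv.refl := by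
  let O := Localization.AtPrime P
  let g : O →+* O := Localization.localRingHom P P (σ : S →+* S) hP.symm
  have hg : ∀ x : S, g (algebraMap S O x) = algebraMap S O (σ x) :=
    Localization.localRingHom_to_map P P (σ : S →+* S) hP.symm
  let g' : O →ₐ[R] O := { g with
    commutes' := fun r => by
      change g _ = _
      rw [IsScalarTower.algebraMap_apply R S O, hg, AlgEquiv.commutes] }
  -- The identity and the extension of `σ` agree modulo the maximal ideal, hence modulo all its
  -- powers by formal unramifiedness, hence everywhere by Krull's intersection theorem.
  have hbot : ⨅ i, IsLocalRing.maximalIdeal O ^ i = ⊥ :=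
    Ideal.iInf_pow_eq_bot_of_isLocalRing _ (IsLocalRing.maximalIdeal.isMaximal O).ne_top
  have hsub : ∀ x : S, algebraMap S O (σ x) - algebraMap S O x ∈ IsLocalRing.maximalIdeal O := by
    intro x
    rw [← map_sub, IsLocalization.AtPrime.to_map_mem_maximal_iff O P]
    exact h x
  have hgid : g' = AlgHom.id R O := by
    refine Algebra.FormallyUnramified.ext_of_iInf (I := IsLocalRing.maximalIdeal O) hbot
      fun x => ?_
    have hcomp : (Ideal.Quotient.mk (IsLocalRing.maximalIdeal O)).comp g =
        Ideal.Quotient.mk (IsLocalRing.maximalIdeal O) := by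
      refine IsLocalization.ringHom_ext P.primeCompl (RingHom.ext fun x => ?_)
      change Ideal.Quotient.mk _ (g (algebraMap S O x)) = Ideal.Quotient.mk _ (algebraMap S O x)
      rw [hg]
      exact Ideal.Quotient.eq.2 (hsub x)
    exact RingHom.congr_fun hcomp x
  ext x
  refine FaithfulSMul.algebraMap_injective S O ?_
  rw [← hg]
  exact DFunLike.congr_fun hgid (algebraMap S O x)

/-- At a prime over `p` the ideal generated by `p` is locally the maximal ideal, and elsewhere it is
locally the unit ideal, so it is radical. -/
theorem Algebra.IsUnramifiedIn.isReduced_quotient_map {R S : Type*} [CommRing R] [CommRing S]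
    [Algebra R S] [Algebra.EssFiniteType R S] {p : Ideal R} [p.IsMaximal]
    (h : Algebra.IsUnramifiedIn S p) : IsReduced (S ⧸ p.map (algebraMap R S)) := by
  rw [← Ideal.isRadical_iff_quotient_reduced]
  intro x hx
  refine Ideal.mem_of_localization_maximal fun P hP => ?_
  by_cases hpP : p.map (algebraMap R S) ≤ P
  · have : P.LiesOver p := ⟨(‹p.IsMaximal›.eq_of_le
      (Ideal.IsPrime.under R P).ne_top (Ideal.map_le_iff_le_comap.1 hpP))⟩
    have := h P hP.isPrime inferInstance
    let := Localization.AtPrime.algebraOfLiesOver p P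
    rw [Ideal.map_map, ← IsScalarTower.algebraMap_eq,
      ((Algebra.isUnramifiedAt_iff_map_eq R p P).1 inferInstance).2,
      IsLocalization.AtPrime.to_map_mem_maximal_iff _ P]
    exact hP.isPrime.radical_le_iff.2 hpP hx
  · obtain ⟨y, hy, hyP⟩ := SetLike.not_le_iff_exists.1 hpP
    rw [Ideal.eq_top_of_isUnit_mem _ (Ideal.mem_map_of_mem _ hy)
      (IsLocalization.map_units (Localization.AtPrime P) (⟨y, hyP⟩ : P.primeCompl))]
    trivial

/-- If `p` is unramified in `S`, every unit of `ℤ_p` is of the form `z * σ z` with `z` in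
`ℤ_p ⊗ S`, for any nontrivial involution `σ` of `S`. The equation is solved in `S / p S`, where
unramifiedness makes `σ` act nontrivially on each residue field it preserves, and the solution is
lifted `p`-adically. -/
theorem exists_mul_map_involution_eq_of_isUnramifiedIn {S : Type*} [CommRing S] [IsDomain S]
    [CharZero S]
    [Module.Finite ℤ S] [Module.Free ℤ S] (p : ℕ) [Fact p.Prime]
    (hp : Algebra.IsUnramifiedIn S (Ideal.span {(p : ℤ)})) (σ : S ≃ₐ[ℤ] S)
    (hσ : ∀ x, σ (σ x) = x) (hne : σ ≠ AlgEquiv.refl) (u : ℤ_[p]ˣ) :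
    ∃ z : ℤ_[p] ⊗[ℤ] S, z * Algebra.TensorProduct.map (AlgHom.id ℤ_[p] ℤ_[p]) (σ : S →ₐ[ℤ] S) z =
      algebraMap ℤ_[p] _ u := by
  have hprime : Prime (p : ℤ) := Nat.prime_iff_prime_int.1 (Fact.out : p.Prime)
  have : (Ideal.span {(p : ℤ)}).IsMaximal :=
    PrincipalIdealRing.isMaximal_of_irreducible hprime.irreducible
  have : IsNoetherianRing S := IsNoetherianRing.of_finite ℤ S
  let J : Ideal S := (Ideal.span {(p : ℤ)}).map (algebraMap ℤ S)
  have hJ : J = Ideal.span {(p : S)} := by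
    simp only [J, Ideal.map_span, Set.image_singleton]
    simp
  have hJmap : J = J.map (σ : S →+* S) := by
    rw [hJ, Ideal.map_span, Set.image_singleton]
    simp
  have : IsReduced (S ⧸ J) := hp.isReduced_quotient_map
  have : Finite (S ⧸ J) := by
    refine Ideal.finiteQuotientOfFreeOfNeBot J ?_
    rw [hJ, Ne, Ideal.span_singleton_eq_bot]
    exact Nat.cast_ne_zero.2 (Fact.out : p.Prime).ne_zero
  let τ : (S ⧸ J) ≃+* (S ⧸ J) := Ideal.quotientEquiv J J σ.toRingEquiv hJmap
  have hτ : ∀ x, τ (Ideal.Quotient.mk J x) = Ideal.Quotient.mk J (σ x) := fun _ => rfl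
  have hττ : ∀ x, τ (τ x) = x := by
    intro x
    obtain ⟨x, rfl⟩ := Ideal.Quotient.mk_surjective x
    rw [hτ, hτ, hσ]
  have hτne : ∀ Q : Ideal (S ⧸ J), Q.IsMaximal → Q.comap τ = Q → ∃ x, τ x - x ∉ Q := by
    intro Q hQ hQτ
    by_contra! hcon
    -- Otherwise `σ` would lie in the inertia group of an unramified prime over `p`.
    let P : Ideal S := Q.comap (Ideal.Quotient.mk J)
    have hP : P.IsMaximal := Ideal.comap_isMaximal_of_surjective _ Ideal.Quotient.mk_surjective
    have hJP : J ≤ P := by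
      intro x hx
      change Ideal.Quotient.mk J x ∈ Q
      rw [Ideal.Quotient.eq_zero_iff_mem.2 hx]
      exact zero_mem _
    have : P.LiesOver (Ideal.span {(p : ℤ)}) := ⟨‹(Ideal.span {(p : ℤ)}).IsMaximal›.eq_of_le
      (Ideal.IsPrime.under ℤ P).ne_top (Ideal.map_le_iff_le_comap.1 hJP)⟩
    have := hp P hP.isPrime inferInstance
    refine hne (σ.eq_refl_of_isUnramifiedAt P ?_ fun x => ?_)
    · ext x
      change Ideal.Quotient.mk J (σ x) ∈ Q ↔ Ideal.Quotient.mk J x ∈ Q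
      rw [← hτ]
      conv_rhs => rw [← hQτ]
      rfl
    · exact hcon (Ideal.Quotient.mk J x)
  let A := ℤ_[p] ⊗[ℤ] S
  let φ : A →ₐ[ℤ_[p]] A := Algebra.TensorProduct.map (AlgHom.id ℤ_[p] ℤ_[p]) (σ : S →ₐ[ℤ] S)
  have hφ : ∀ a s, φ (a ⊗ₜ s) = a ⊗ₜ σ s :=
    Algebra.TensorProduct.map_tmul _ _
  have hφφ : ∀ x, φ (φ x) = x := by
    intro (x : ℤ_[p] ⊗[ℤ] S)
    induction x with
    | zero => simp
    | add x y hx hy => rw [map_add, map_add, hx, hy]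
    | tmul a s => rw [hφ, hφ, hσ]
  let ψ : A ≃+* A := (AlgEquiv.ofAlgHom φ φ (AlgHom.ext hφφ) (AlgHom.ext hφφ)).toRingEquiv
  have hψ : ∀ x, ψ x = φ x := fun _ => rfl
  let I : Ideal A := (IsLocalRing.maximalIdeal ℤ_[p]).map (algebraMap ℤ_[p] A)
  have hI : I = Ideal.span {(p : A)} := by
    simp only [I, PadicInt.maximalIdeal_eq_span_p, Ideal.map_span, Set.image_singleton]
    simp
  have : IsAdicComplete I A := (IsAdicComplete.map_algebraMap_iff _ _).2
    (IsAdicComplete.of_finite_of_isNoetherianRing _ A)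
  have hIψ : I ≤ I.comap ψ := by
    rw [hI, Ideal.span_singleton_le_iff_mem, Ideal.mem_comap, map_natCast]
    exact Ideal.mem_span_singleton_self _
  have hJI : ∀ s ∈ J, (1 : ℤ_[p]) ⊗ₜ[ℤ] s ∈ I := by
    intro s hs
    rw [hJ, Ideal.mem_span_singleton'] at hs
    obtain ⟨r, rfl⟩ := hs
    rw [hI, Ideal.mem_span_singleton']
    exact ⟨1 ⊗ₜ r, by
      rw [← map_natCast (Algebra.TensorProduct.includeRight : S →ₐ[ℤ] ℤ_[p] ⊗[ℤ] S)]
      exact (Algebra.TensorProduct.tmul_mul_tmul _ _ _ _).trans (by rw [mul_one])⟩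
  obtain ⟨t, ht⟩ : ∃ t, t + ψ t = 1 := by
    obtain ⟨t, ht⟩ := exists_add_involution_eq_one_of_finite_reduced τ hττ hτne
    obtain ⟨t, rfl⟩ := Ideal.Quotient.mk_surjective t
    refine exists_add_involution_eq_one_of_mod I ψ hφφ (t := 1 ⊗ₜ t) ?_
    rw [hψ, hφ, ← TensorProduct.tmul_add, Algebra.TensorProduct.one_def, ← TensorProduct.tmul_sub]
    exact hJI _ (Ideal.Quotient.eq.1 ht)
  -- Modulo `p` the unit `u` is an integer `n`, so that the equation makes sense in `S / p S`.
  obtain ⟨n, -, hn⟩ := PadicInt.exists_mem_range (u : ℤ_[p])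
  obtain ⟨z, hz⟩ := exists_mul_involution_eq_of_finite_reduced τ hττ hτne (c := (n : S ⧸ J))
    (map_natCast τ n)
  obtain ⟨z, rfl⟩ := Ideal.Quotient.mk_surjective z
  refine exists_mul_involution_eq_of_mod I ψ hIψ ht hφφ
    (c := Units.map (algebraMap ℤ_[p] A).toMonoidHom u) (φ.commutes _) (z := 1 ⊗ₜ z) ?_
  have h1 : (1 : ℤ_[p]) ⊗ₜ[ℤ] (z * σ z - n) ∈ I := hJI _ (Ideal.Quotient.eq.1 hz)
  have h2 : algebraMap ℤ_[p] A (u - n) ∈ I := Ideal.mem_map_of_mem _ hn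
  have := sub_mem h1 h2
  have hnat : (1 : ℤ_[p]) ⊗ₜ[ℤ] (n : S) = (n : A) :=
    map_natCast (Algebra.TensorProduct.includeRight : S →ₐ[ℤ] ℤ_[p] ⊗[ℤ] S) n
  rw [TensorProduct.tmul_sub, map_sub, map_natCast, hnat, sub_sub_sub_cancel_right] at this
  rw [hψ, hφ]
  have hmul : ((1 : ℤ_[p]) ⊗ₜ[ℤ] z : A) * (1 ⊗ₜ σ z) = 1 ⊗ₜ (z * σ z) :=
    (Algebra.TensorProduct.tmul_mul_tmul _ _ _ _).trans (by rw [mul_one])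
  rw [hmul]
  exact this

/-! ### The integers of the centre inside the local algebra -/

namespace UnitaryPEL

section Local

variable (p : ℕ) [Fact p.Prime]

theorem starLocal_tmul (B : Type*) [Ring B] [Algebra ℚ B] [StarRing B] (a : ℚ_[p]) (b : B) :
    starLocal p B (a ⊗ₜ[ℚ] b) = a ⊗ₜ[ℚ] star b := rfl

/-- The canonical homomorphism `ℤ_p ⊗ 𝓞 F → ℚ_p ⊗ B`. -/
noncomputable def integersToLocal (F B : Type*) [Field F] [NumberField F] [Ring B] [Algebra ℚ B]
    [Algebra F B] : (ℤ_[p] ⊗[ℤ] 𝓞 F) →ₐ[ℤ_[p]] (ℚ_[p] ⊗[ℚ] B) :=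
  Algebra.TensorProduct.lift (Algebra.ofId ℤ_[p] _)
    (((Algebra.TensorProduct.includeRight : B →ₐ[ℚ] ℚ_[p] ⊗[ℚ] B) : B →+* ℚ_[p] ⊗[ℚ] B).comp
      ((algebraMap F B).comp (algebraMap (𝓞 F) F))).toIntAlgHom
    (fun a _ => by rw [Algebra.ofId_apply]; exact Algebra.commute_algebraMap_left a _)

theorem integersToLocal_tmul (F B : Type*) [Field F] [NumberField F] [Ring B] [Algebra ℚ B]
    [Algebra F B] (a : ℤ_[p]) (s : 𝓞 F) :
    integersToLocal p F B (a ⊗ₜ[ℤ] s) = (a : ℚ_[p]) ⊗ₜ[ℚ] algebraMap F B s := by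
  rw [integersToLocal, Algebra.TensorProduct.lift_tmul, Algebra.ofId_apply, ← Algebra.smul_def]
  change a • ((1 : ℚ_[p]) ⊗ₜ[ℚ] algebraMap F B s) = _
  rw [TensorProduct.smul_tmul', Algebra.smul_def, mul_one]
  rfl

theorem integersToLocal_commute (F B : Type*) [Field F] [NumberField F] [Ring B] [Algebra ℚ B]
    [Algebra F B] (z : ℤ_[p] ⊗[ℤ] 𝓞 F) (y : ℚ_[p] ⊗[ℚ] B) :
    Commute (integersToLocal p F B z) y := by
  induction z with
  | zero => rw [map_zero]; exact Commute.zero_left y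
  | add z z' hz hz' => rw [map_add]; exact hz.add_left hz'
  | tmul a s =>
    induction y with
    | zero => exact Commute.zero_right _
    | add y y' hy hy' => exact hy.add_right hy'
    | tmul c b =>
      rw [integersToLocal_tmul, Commute, SemiconjBy, Algebra.TensorProduct.tmul_mul_tmul,
        Algebra.TensorProduct.tmul_mul_tmul, mul_comm c, Algebra.commutes]

end Local

variable {F B V : Type*} [Field F] [NumberField F] [NumberField.IsCMField F]
    [Ring B] [Algebra ℚ B] [Algebra F B] [FiniteDimensional F B] [IsSimpleRing B]
    [Algebra.IsCentral F B] [StarRing B]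
    [AddCommGroup V] [Module ℚ V] [Module B V] [Module.Finite B V] [Nontrivial V]

/-- Complex conjugation on the ring of integers of a CM field, as an automorphism over `ℤ`. -/
noncomputable def integersConj (F : Type*) [Field F] [NumberField F] [NumberField.IsCMField F] :
    𝓞 F ≃ₐ[ℤ] 𝓞 F :=
  (NumberField.IsCMField.ringOfIntegersComplexConj F).restrictScalars ℤ

theorem coe_integersConj (x : 𝓞 F) :
    (integersConj F x : F) = NumberField.IsCMField.complexConj F x := rfl

theorem integersConj_integersConj (x : 𝓞 F) : integersConj F (integersConj F x) = x := by
  ext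
  rw [coe_integersConj, coe_integersConj, NumberField.IsCMField.complexConj_apply_apply]

theorem integersConj_ne_refl : integersConj F ≠ AlgEquiv.refl := by
  intro h
  refine NumberField.IsCMField.complexConj_ne_one (K := F) (AlgEquiv.ext fun x => ?_)
  obtain ⟨a, b, -, rfl⟩ := IsFractionRing.div_surjective (A := 𝓞 F) x
  have hx : ∀ s : 𝓞 F, NumberField.IsCMField.complexConj F (s : F) = s := fun s => by
    rw [← coe_integersConj, h]; rfl
  rw [map_div₀, hx, hx]
  rfl

variable (p : ℕ) [Fact p.Prime]

theorem Datum.starLocal_integersToLocal (D : Datum F B V) (z : ℤ_[p] ⊗[ℤ] 𝓞 F) :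
    starLocal p B (integersToLocal p F B z) = integersToLocal p F B
      (Algebra.TensorProduct.map (AlgHom.id ℤ_[p] ℤ_[p]) (integersConj F : 𝓞 F →ₐ[ℤ] 𝓞 F) z) := by
  induction z with
  | zero => simp only [map_zero]
  | add z z' hz hz' => simp only [map_add, hz, hz']
  | tmul a s =>
    rw [integersToLocal_tmul, starLocal_tmul, D.star_algebraMap, Algebra.TensorProduct.map_tmul,
      integersToLocal_tmul]
    rfl

theorem Datum.form_actionLocal (D : Datum F B V) (b : ℚ_[p] ⊗[ℚ] B) (v w : ℚ_[p] ⊗[ℚ] V) :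
    D.form.baseChange ℚ_[p] (actionLocal p B V b v) w =
      D.form.baseChange ℚ_[p] v (actionLocal p B V (starLocal p B b) w) := by
  induction b with
  | zero => simp only [map_zero, LinearMap.zero_apply]
  | add b b' hb hb' => simp only [map_add, LinearMap.add_apply, hb, hb']
  | tmul a b =>
    induction v with
    | zero => simp only [map_zero, LinearMap.zero_apply]
    | add v v' hv hv' => simp only [map_add, LinearMap.add_apply, hv, hv']
    | tmul c v =>
      induction w with
      | zero => simp only [map_zero]
      | add w w' hw hw' => simp only [map_add, hw, hw']
      | tmul d w =>
        rw [starLocal_tmul, actionLocal_tmul, actionLocal_tmul,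
          LinearMap.BilinForm.baseChange_tmul, LinearMap.BilinForm.baseChange_tmul, D.form_smul]
        congr 1
        ring

/-! ### Central similitudes of the lattice -/

namespace Datum.GoodReduction

variable {p} {D : Datum F B V} (M : D.GoodReduction p)

/-- A maximal order contains the integers of the centre: the products of its elements with integers
of the centre span an order. -/
theorem integersToLocal_mem_order (z : ℤ_[p] ⊗[ℤ] 𝓞 F) : integersToLocal p F B z ∈ M.order := by
  let f : M.order ⊗[ℤ_[p]] (ℤ_[p] ⊗[ℤ] 𝓞 F) →ₐ[ℤ_[p]] ℚ_[p] ⊗[ℚ] B :=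
    Algebra.TensorProduct.lift M.order.val (integersToLocal p F B)
      (fun x y => (integersToLocal_commute p F B y x).symm)
  have hf : ∀ x y, f (x ⊗ₜ y) = x * integersToLocal p F B y := fun _ _ =>
    Algebra.TensorProduct.lift_tmul _ _ _ _ _
  have hle : M.order ≤ f.range := fun x hx =>
    ⟨⟨x, hx⟩ ⊗ₜ 1, (hf _ _).trans (by rw [map_one, mul_one])⟩
  have hfin : Module.Finite ℤ_[p] M.order := Module.Finite.iff_fg.2 M.order_isLattice.fg
  have hlat : (Subalgebra.toSubmodule f.range).IsLattice ℚ_[p] := by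
    have := M.order_isLattice
    refine Submodule.IsLattice.of_le_of_isLattice_of_fg ℚ_[p] (M := Subalgebra.toSubmodule M.order)
      hle ?_
    have hfg := (Module.Finite.fg_top (R := ℤ_[p])
      (M := M.order ⊗[ℤ_[p]] (ℤ_[p] ⊗[ℤ] 𝓞 F))).map f.toLinearMap
    rwa [Submodule.map_top] at hfg
  rw [← M.order_maximal f.range hlat hle]
  exact ⟨1 ⊗ₜ z, (hf _ _).trans (by rw [OneMemClass.coe_one, one_mul])⟩

theorem orderAction_mul (b b' : M.order) :
    M.orderAction (b * b') = M.orderAction b ∘ₗ M.orderAction b' := by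
  ext v
  change actionLocal p B V (b * b') v = actionLocal p B V b (actionLocal p B V b' v)
  rw [map_mul, Module.End.mul_apply]

theorem orderAction_algebraMap (c : ℤ_[p]) :
    M.orderAction (algebraMap ℤ_[p] M.order c) = c • LinearMap.id := by
  ext v
  change actionLocal p B V (algebraMap ℤ_[p] (ℚ_[p] ⊗[ℚ] B) c) v = c • (v : ℚ_[p] ⊗[ℚ] V)
  rw [IsScalarTower.algebraMap_apply ℤ_[p] ℚ_[p], AlgHom.commutes]
  rfl

theorem latticeForm_orderAction (b b' : M.order) (hb : starLocal p B b = b') (v w : M.lattice) :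
    M.latticeForm (M.orderAction b v) w = M.latticeForm v (M.orderAction b' w) := by
  apply PadicInt.ext
  change D.form.baseChange ℚ_[p] (actionLocal p B V b v) w =
    D.form.baseChange ℚ_[p] v (actionLocal p B V b' w)
  rw [D.form_actionLocal p, hb]

theorem latticeForm_baseChange_orderAction (R : Type) [CommRing R] [Algebra ℤ_[p] R]
    (b b' : M.order) (hb : starLocal p B b = b') (v w : R ⊗[ℤ_[p]] M.lattice) :
    M.latticeForm.baseChange R ((M.orderAction b).baseChange R v) w =
      M.latticeForm.baseChange R v ((M.orderAction b').baseChange R w) := by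
  induction v with
  | zero => simp only [map_zero, LinearMap.zero_apply]
  | add v v' hv hv' => simp only [map_add, LinearMap.add_apply, hv, hv']
  | tmul c v =>
    induction w with
    | zero => simp only [map_zero]
    | add w w' hw hw' => simp only [map_add, hw, hw']
    | tmul d w =>
      rw [LinearMap.baseChange_tmul, LinearMap.baseChange_tmul,
        LinearMap.BilinForm.baseChange_tmul, LinearMap.BilinForm.baseChange_tmul,
        M.latticeForm_orderAction b b' hb]

/-- An element of `G(R)` acting through the order is central: it still acts through the order after
base change, and every element of `G(S)` commutes with the order. -/
theorem mem_Z_of_eq_orderAction (R : Type) [CommRing R] [Algebra ℤ_[p] R] (ζ : M.G R) (b : M.order)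
    (hζ : ∀ v, ζ.1 v = (M.orderAction b).baseChange R v) : ζ ∈ M.Z R := by
  intro S _ _ _ _
  have hlin : (ζ.1 : R ⊗[ℤ_[p]] M.lattice →ₗ[R] R ⊗[ℤ_[p]] M.lattice) =
      (M.orderAction b).baseChange R := LinearMap.ext hζ
  have key : ∀ v : S ⊗[ℤ_[p]] M.lattice,
      (M.mapG R S ζ).1 v = (M.orderAction b).baseChange S v := by
    intro v
    obtain ⟨x, rfl⟩ := (M.cancel R S).surjective v
    rw [action_cancel, ← hlin]
    change M.cancel R S (ζ.1.baseChange R S _ _ ((M.cancel R S).symm (M.cancel R S x))) = _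
    rw [LinearEquiv.symm_apply_apply]
    rfl
  rw [Subgroup.mem_center_iff]
  intro h
  ext1
  ext1 v
  change h.1 ((M.mapG R S ζ).1 v) = (M.mapG R S ζ).1 (h.1 v)
  rw [key, key]
  exact h.2.1 b v

/-- The centre contains elements of every similitude ratio `c` in `ℤ_pˣ`: an element `z` of
`ℤ_p ⊗ 𝓞 F` with `z * conj z = c` acts on the lattice with ratio `c`, and its action commutes with
every automorphism commuting with the order, after any base change. -/
theorem exists_mem_Z_similitude (c : ℤ_[p]ˣ) : ∃ ζ ∈ M.Z ℤ_[p],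
    ∀ v w : ℤ_[p] ⊗[ℤ_[p]] M.lattice,
      M.latticeForm.baseChange ℤ_[p] (ζ.1 v) (ζ.1 w) = c * M.latticeForm.baseChange ℤ_[p] v w := by
  obtain ⟨z, hz⟩ := exists_mul_map_involution_eq_of_isUnramifiedIn p M.unramified (integersConj F)
    integersConj_integersConj integersConj_ne_refl c
  have hstar := D.starLocal_integersToLocal p z
  revert hz hstar
  generalize Algebra.TensorProduct.map (AlgHom.id ℤ_[p] ℤ_[p])
    (integersConj F : 𝓞 F →ₐ[ℤ] 𝓞 F) z = z'
  intro hz hstar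
  let b : M.order := ⟨integersToLocal p F B z, M.integersToLocal_mem_order z⟩
  let b' : M.order := ⟨integersToLocal p F B z', M.integersToLocal_mem_order z'⟩
  have hbb' : b * b' = algebraMap ℤ_[p] M.order c := Subtype.ext (by
    change integersToLocal p F B z * integersToLocal p F B z' = algebraMap ℤ_[p] _ (c : ℤ_[p])
    rw [← map_mul, hz, AlgHom.commutes])
  have hb'b : b' * b = algebraMap ℤ_[p] M.order c := by
    rw [← hbb']
    exact Subtype.ext (integersToLocal_commute p F B z' _)
  have hcomm : ∀ x : M.order, M.orderAction b ∘ₗ M.orderAction x =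
      M.orderAction x ∘ₗ M.orderAction b := fun x => by
    rw [← orderAction_mul, ← orderAction_mul]
    exact congrArg M.orderAction (Subtype.ext (integersToLocal_commute p F B z _))
  have hact : M.orderAction b' ∘ₗ M.orderAction b = (c : ℤ_[p]) • LinearMap.id := by
    rw [← orderAction_mul, hb'b, orderAction_algebraMap]
  have hact' : M.orderAction b ∘ₗ M.orderAction b' = (c : ℤ_[p]) • LinearMap.id := by
    rw [← orderAction_mul, hbb', orderAction_algebraMap]
  -- The action of `z` is invertible, with inverse the action of `c⁻¹ * conj z`.
  let e : M.lattice ≃ₗ[ℤ_[p]] M.lattice :=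
    LinearEquiv.ofLinearMap (M.orderAction b) ((↑c⁻¹ : ℤ_[p]) • M.orderAction b')
      (by rw [LinearMap.comp_smul, hact', smul_smul, Units.inv_mul, one_smul])
      (by rw [LinearMap.smul_comp, hact, smul_smul, Units.inv_mul, one_smul])
  have he : ∀ v, e.baseChange ℤ_[p] ℤ_[p] _ _ v = (M.orderAction b).baseChange ℤ_[p] v :=
    fun _ => rfl
  have hsim : ∀ v w : ℤ_[p] ⊗[ℤ_[p]] M.lattice,
      M.latticeForm.baseChange ℤ_[p] (e.baseChange ℤ_[p] ℤ_[p] _ _ v)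
        (e.baseChange ℤ_[p] ℤ_[p] _ _ w) = c * M.latticeForm.baseChange ℤ_[p] v w := by
    intro v w
    rw [he, he, M.latticeForm_baseChange_orderAction ℤ_[p] b b' hstar,
      ← LinearMap.comp_apply (LinearMap.baseChange ℤ_[p] _), ← LinearMap.baseChange_comp, hact,
      LinearMap.baseChange_smul, LinearMap.baseChange_id,
      LinearMap.smul_apply, map_smul, LinearMap.id_apply, smul_eq_mul]
  refine ⟨⟨e.baseChange ℤ_[p] ℤ_[p] _ _, fun x v => ?_, c, hsim⟩, ?_, hsim⟩
  · rw [he, he, ← LinearMap.comp_apply, ← LinearMap.comp_apply, ← LinearMap.baseChange_comp,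
      ← LinearMap.baseChange_comp, hcomm]
  · exact M.mem_Z_of_eq_orderAction ℤ_[p] _ b he

end Datum.GoodReduction

end UnitaryPEL

theorem mainTheorem9 {F B V : Type*} [Field F] [NumberField F] [NumberField.IsCMField F]
    [Ring B] [Algebra ℚ B] [Algebra F B] [FiniteDimensional F B] [IsSimpleRing B]
    [Algebra.IsCentral F B] [StarRing B]
    [AddCommGroup V] [Module ℚ V] [Module B V] [Module.Finite B V] [Nontrivial V]
    (D : UnitaryPEL.Datum F B V) (p : ℕ) [Fact p.Prime] (M : D.GoodReduction p) :
    Function.Surjective (M.mulMap ℤ_[p]) := by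
  intro g
  obtain ⟨-, c, hc⟩ := g.2
  obtain ⟨ζ, hζ, hsim⟩ := M.exists_mem_Z_similitude c
  refine ⟨(⟨g * ζ⁻¹, fun v w => ?_⟩, ⟨ζ, hζ⟩), inv_mul_cancel_right g ζ⟩
  have hinv : ∀ v, ζ.1 ((ζ⁻¹).1 v) = v := fun v => ζ.1.apply_symm_apply v
  have h : M.latticeForm.baseChange ℤ_[p] (g.1 ((ζ⁻¹).1 v)) (g.1 ((ζ⁻¹).1 w)) =
      M.latticeForm.baseChange ℤ_[p] v w := by
    rw [hc, ← hsim, hinv, hinv]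
  exact h
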